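/- Let $H_1, H_2$ be infinite-dimensional separable complex Hilbert spaces, let $A$ be a positive bounded operator on $H_2$ and let $X : H_2 \to H_1$ be a bounded operator. Suppose that the block operator $$T = \begin{bmatrix} I_{H_1} & X \\ X^* & A \end{bmatrix}$$ on the Hilbert space direct sum $H_1 \oplus H_2$ is positive. Call a bounded operator $S$ between Hilbert spaces absolutely norm attaining ($\mathcal{AN}$) if for every non-zero closed subspace $M$ of its domain there is a unit vector $x \in M$ with $\|Sx\| = \|S|_M\|$, and let $\sigma_{ess}(A)$ be the set of all $\mu \in \mathbb{C}$ for which $A - \mu I$ is not Fredholm. Then $T$ is $\mathcal{AN}$ if and only if $A$ is $\mathcal{AN}$ with $\sigma_{ess}(A) = \{1\}$ and $X$ has finite rank. -/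

import Mathlib

namespace AbsNormAttaining

variable {H H₁ H₂ : Type*}
  [NormedAddCommGroup H] [InnerProductSpace ℂ H]
  [NormedAddCommGroup H₁] [InnerProductSpace ℂ H₁]
  [NormedAddCommGroup H₂] [InnerProductSpace ℂ H₂]

/-- A bounded operator `T` is norm attaining if `‖T x‖ = ‖T‖` for some unit vector `x`. -/
def IsNormAttaining (T : H₁ →L[ℂ] H₂) : Prop :=
  ∃ x : H₁, ‖x‖ = 1 ∧ ‖T x‖ = ‖T‖

/-- A bounded operator `T` is absolutely norm attaining (an AN-operator) if its restriction to
every non-zero closed subspace of its domain is norm attaining. -/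
def IsAN (T : H₁ →L[ℂ] H₂) : Prop :=
  ∀ M : Submodule ℂ H₁, IsClosed (M : Set H₁) → M ≠ ⊥ → IsNormAttaining (T ∘L M.subtypeL)

/-- The essential spectrum: all complex `μ` for which `T - μ I` is not a Fredholm operator. -/
def essentialSpectrum (T : H →L[ℂ] H) : Set ℂ :=
  {μ : ℂ | ¬ (T - μ • ContinuousLinearMap.id ℂ H).IsFredholm}

/-- The operator on the Hilbert space direct sum `H₁ ⊕ H₂`, realised as `WithLp 2 (H₁ × H₂)`,
given by the block matrix `[[A₁₁, A₁₂], [A₂₁, A₂₂]]`. -/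
noncomputable def blockOperator (A₁₁ : H₁ →L[ℂ] H₁) (A₁₂ : H₂ →L[ℂ] H₁)
    (A₂₁ : H₁ →L[ℂ] H₂) (A₂₂ : H₂ →L[ℂ] H₂) :
    WithLp 2 (H₁ × H₂) →L[ℂ] WithLp 2 (H₁ × H₂) :=
  (WithLp.prodContinuousLinearEquiv 2 ℂ H₁ H₂).symm.toContinuousLinearMap ∘L
    ((A₁₁ ∘L WithLp.fstL 2 ℂ H₁ H₂ + A₁₂ ∘L WithLp.sndL 2 ℂ H₁ H₂).prod
      (A₂₁ ∘L WithLp.fstL 2 ℂ H₁ H₂ + A₂₂ ∘L WithLp.sndL 2 ℂ H₁ H₂))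

theorem blockOperator_apply (A₁₁ : H₁ →L[ℂ] H₁) (A₁₂ : H₂ →L[ℂ] H₁)
    (A₂₁ : H₁ →L[ℂ] H₂) (A₂₂ : H₂ →L[ℂ] H₂) (x : WithLp 2 (H₁ × H₂)) :
    blockOperator A₁₁ A₁₂ A₂₁ A₂₂ x =
      WithLp.toLp 2 (A₁₁ x.fst + A₁₂ x.snd, A₂₁ x.fst + A₂₂ x.snd) := rfl

end AbsNormAttaining

/-!
The proof rests on the structure of positive AN-operators on an infinite-dimensional Hilbert space:
a positive operator `T` is AN if and only if, for some real `α ≥ 0`, the difference `T - α` is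
compact and `T ≥ α` as quadratic forms on a subspace of finite codimension
(`IsCompactPerturbationAbove`).

Sufficiency (`IsCompactPerturbationAbove.isAN`): let `S` be the restriction of `T` to an
infinite-dimensional closed subspace `M`. Then `S† S - α²` is compact. If `‖S‖ > α`, a maximizing
sequence of unit vectors subconverges; if `‖S‖ = α`, any unit vector of `M` in the subspace where
`T ≥ α` attains the norm.

Necessity (`IsAN.exists_isCompactPerturbationAbove`): norm attainment on invariant subspaces yields
a Hilbert basis of eigenvectors. If an orthonormal family has pairwise orthogonal images, the norms
of the images have a maximum (`IsAN.exists_norm_apply_le`). Applied to eigenvectors, this excludes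
infinitely many eigenvalues below the essential value; applied to mixtures of eigenvectors for
small and large eigenvalues, it excludes two distinct accumulation points
(`IsAN.finite_le_or_finite_ge`).

By the Fredholm alternative, `α` is then the only essential spectral value
(`essentialSpectrum_eq_singleton`). For the block operator, compression to the infinite-dimensional
`H₁` forces `α = 1`. The quadratic form of `T - 1` is `2 Re ⟪X y, x⟫ + ⟪(A - 1) y, y⟫`; it is affine
under real scaling of `x`, so its nonnegativity on a subspace of finite codimension forces
`⟪X y, x⟫ = 0` there, and `X` has finite rank. Conversely, if `X` has finite rank, the cross term
vanishes on a subspace of finite codimension and `T - 1` inherits the structure of `A - 1`.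
-/

open AbsNormAttaining Filter Topology
open scoped InnerProductSpace

/-! ### Norm attainment for a single operator -/

section NormAttainment

variable {E F : Type*} [NormedAddCommGroup E] [InnerProductSpace ℂ E] [CompleteSpace E]
  [NormedAddCommGroup F] [InnerProductSpace ℂ F] [CompleteSpace F]

/-- Quantitative form of the fact that a unit vector at which `S` attains its norm is an
eigenvector of `S† S` for the eigenvalue `‖S‖ ^ 2`. -/
theorem norm_sq_smul_sub_adjoint_apply_sq_le (S : E →L[ℂ] F) {x : E} (hx : ‖x‖ = 1) :
    ‖((‖S‖ ^ 2 : ℝ) : ℂ) • x - ContinuousLinearMap.adjoint S (S x)‖ ^ 2 ≤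
      2 * ‖S‖ ^ 2 * (‖S‖ ^ 2 - ‖S x‖ ^ 2) := by
  have h1 : ‖ContinuousLinearMap.adjoint S (S x)‖ ≤ ‖S‖ ^ 2 := by
    calc _ ≤ ‖ContinuousLinearMap.adjoint S‖ * (‖S‖ * ‖x‖) :=
          (ContinuousLinearMap.le_opNorm _ _).trans (by gcongr; exact S.le_opNorm x)
      _ = ‖S‖ ^ 2 := by rw [hx, LinearIsometryEquiv.norm_map]; ring
  have h2 : ‖ContinuousLinearMap.adjoint S (S x)‖ ^ 2 ≤ (‖S‖ ^ 2) ^ 2 := by gcongr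
  rw [norm_sub_sq (𝕜 := ℂ), inner_smul_left, ContinuousLinearMap.adjoint_inner_right,
    inner_self_eq_norm_sq_to_K, norm_smul, hx]
  have h3 : RCLike.re ((starRingEnd ℂ) ((‖S‖ ^ 2 : ℝ) : ℂ) * ((‖S x‖ : ℂ) ^ 2)) =
      ‖S‖ ^ 2 * ‖S x‖ ^ 2 := by
    rw [Complex.conj_ofReal, ← Complex.ofReal_pow, ← Complex.ofReal_mul]
    exact Complex.ofReal_re _
  have h4 : ‖((‖S‖ ^ 2 : ℝ) : ℂ)‖ = ‖S‖ ^ 2 := by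
    rw [Complex.norm_real, Real.norm_of_nonneg (by positivity)]
  erw [h3]
  rw [h4]
  linarith

theorem inner_map_map_of_norm_attained (S : E →L[ℂ] F) {x : E} (hx : ‖x‖ = 1)
    (hS : ‖S x‖ = ‖S‖) (z : E) : ⟪S x, S z⟫_ℂ = ((‖S‖ ^ 2 : ℝ) : ℂ) * ⟪x, z⟫_ℂ := by
  have h := norm_sq_smul_sub_adjoint_apply_sq_le S hx
  rw [hS, sub_self, mul_zero] at h
  have h0 := sub_eq_zero.1 (norm_eq_zero.1 (pow_eq_zero_iff two_ne_zero |>.1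
    (le_antisymm h (sq_nonneg _))))
  rw [← ContinuousLinearMap.adjoint_inner_left, ← h0, inner_smul_left, Complex.conj_ofReal]

omit [CompleteSpace E] [CompleteSpace F] in
theorem exists_seq_norm_tendsto [Nontrivial E] (S : E →L[ℂ] F) :
    ∃ x : ℕ → E, (∀ n, ‖x n‖ = 1) ∧ Tendsto (fun n => ‖S (x n)‖) atTop (𝓝 ‖S‖) := by
  have key : ∀ n : ℕ, ∃ x : E, ‖x‖ = 1 ∧ ‖S‖ - 1 / ((n : ℝ) + 1) ≤ ‖S x‖ := by
    intro n
    by_contra! hcon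
    have hp : (0 : ℝ) < 1 / ((n : ℝ) + 1) := by positivity
    obtain ⟨e, he⟩ := exists_norm_eq E (zero_le_one (α := ℝ))
    have hnn : 0 ≤ ‖S‖ - 1 / ((n : ℝ) + 1) := (norm_nonneg _).trans (hcon e he).le
    have := S.opNorm_le_of_unit_norm (𝕜 := ℂ) hnn fun x hx => (hcon x hx).le
    linarith
  choose x hx1 hx2 using key
  refine ⟨x, hx1, tendsto_of_tendsto_of_tendsto_of_le_of_le ?_ tendsto_const_nhds hx2 fun n => ?_⟩
  · simpa using tendsto_const_nhds.sub (tendsto_one_div_add_atTop_nhds_zero_nat (𝕜 := ℝ))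
  · simpa [hx1 n] using S.le_opNorm (x n)

omit [CompleteSpace E] [CompleteSpace F] in
theorem isNormAttaining_of_finiteDimensional [Nontrivial E] [FiniteDimensional ℂ E]
    (S : E →L[ℂ] F) : IsNormAttaining S := by
  obtain ⟨x, hx, hS⟩ := exists_seq_norm_tendsto S
  have : ProperSpace E := FiniteDimensional.proper ℂ E
  obtain ⟨y, hy, φ, hφ, hlim⟩ := (isCompact_sphere (0 : E) 1).tendsto_subseq
    (x := x) (fun n => by simp [hx n])
  refine ⟨y, by simpa using hy, ?_⟩
  exact tendsto_nhds_unique (((S.continuous.norm.tendsto y).comp hlim))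
    (hS.comp hφ.tendsto_atTop)

/-- If `S† S` is a compact perturbation of the scalar `c` and `c < ‖S‖ ^ 2`, a norm-maximizing
sequence of unit vectors is asymptotically an eigenvector sequence of `S† S`, so compactness makes
it subconverge. -/
theorem isNormAttaining_of_isCompactOperator [Nontrivial E] (S : E →L[ℂ] F) {c : ℝ}
    (hc : c < ‖S‖ ^ 2)
    (hK : IsCompactOperator
      (ContinuousLinearMap.adjoint S ∘L S - (c : ℂ) • ContinuousLinearMap.id ℂ E)) :
    IsNormAttaining S := by
  obtain ⟨x, hx, hS⟩ := exists_seq_norm_tendsto S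
  set K := ContinuousLinearMap.adjoint S ∘L S - (c : ℂ) • ContinuousLinearMap.id ℂ E with hKdef
  obtain ⟨Z, hZ, hZK⟩ := hK.image_closedBall_subset_compact (f := K.toLinearMap) 1
  obtain ⟨y, -, φ, hφ, hlim⟩ := hZ.tendsto_subseq (x := fun n => K (x n))
    (fun n => hZK ⟨x n, by simp [hx n], rfl⟩)
  have hd : Tendsto (fun n => ((‖S‖ ^ 2 : ℝ) : ℂ) • x n -
      ContinuousLinearMap.adjoint S (S (x n))) atTop (𝓝 0) := by
    rw [tendsto_zero_iff_norm_tendsto_zero]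
    have h2 : Tendsto (fun n => 2 * ‖S‖ ^ 2 * (‖S‖ ^ 2 - ‖S (x n)‖ ^ 2)) atTop (𝓝 0) := by
      have := ((hS.pow 2).const_sub (‖S‖ ^ 2)).const_mul (2 * ‖S‖ ^ 2)
      simpa using this
    have h3 := squeeze_zero (fun n => sq_nonneg _)
      (fun n => norm_sq_smul_sub_adjoint_apply_sq_le S (hx n)) h2
    simpa using h3.sqrt
  have hne : ((‖S‖ ^ 2 - c : ℝ) : ℂ) ≠ 0 := by
    exact_mod_cast (sub_pos.2 hc).ne'
  have hconv : Tendsto (x ∘ φ) atTop (𝓝 (((‖S‖ ^ 2 - c : ℝ) : ℂ)⁻¹ • (0 + y))) := by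
    have := ((hd.comp hφ.tendsto_atTop).add hlim).const_smul (((‖S‖ ^ 2 - c : ℝ) : ℂ)⁻¹)
    refine this.congr fun n => ?_
    have : ((‖S‖ ^ 2 : ℝ) : ℂ) • x (φ n) - ContinuousLinearMap.adjoint S (S (x (φ n))) +
        K (x (φ n)) = ((‖S‖ ^ 2 - c : ℝ) : ℂ) • x (φ n) := by
      simp only [hKdef, sub_apply, ContinuousLinearMap.comp_apply,
        smul_apply, ContinuousLinearMap.id_apply, Complex.ofReal_sub]
      module
    simp only [Function.comp_apply, this, smul_smul, inv_mul_cancel₀ hne, one_smul]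
  refine ⟨_, ?_, tendsto_nhds_unique ((S.continuous.norm.tendsto _).comp hconv)
    (hS.comp hφ.tendsto_atTop)⟩
  refine tendsto_nhds_unique hconv.norm ?_
  simp [hx]

end NormAttainment

/-! ### Compact perturbations of scalars are absolutely norm attaining -/

section PositiveOperators

variable {H : Type*} [NormedAddCommGroup H] [InnerProductSpace ℂ H] [CompleteSpace H]

/-- `T` is a compact perturbation of the scalar `α`, and `T ≥ α` holds, in the sense of quadratic
forms, on a closed subspace of finite codimension. For self-adjoint `T` this is the decomposition
`T = α + K - F` with `K` compact and positive and `F` positive of finite rank. -/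
def IsCompactPerturbationAbove (T : H →L[ℂ] H) (α : ℝ) : Prop :=
  IsCompactOperator (T - (α : ℂ) • ContinuousLinearMap.id ℂ H) ∧
    ∃ V : Submodule ℂ H, FiniteDimensional ℂ V ∧
      ∀ x ∈ Vᗮ, α * ‖x‖ ^ 2 ≤ RCLike.re ⟪T x, x⟫_ℂ

omit [CompleteSpace H] in
theorem Submodule.exists_mem_orthogonal_norm_eq_one {M : Submodule ℂ H}
    (hM : ¬ FiniteDimensional ℂ M) (V : Submodule ℂ H) [FiniteDimensional ℂ V] :
    ∃ x ∈ M, x ∈ Vᗮ ∧ ‖x‖ = 1 := by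
  let f : M →ₗ[ℂ] V := (V.orthogonalProjectionOnto ∘L M.subtypeL).toLinearMap
  have hf : LinearMap.ker f ≠ ⊥ := fun h =>
    hM (FiniteDimensional.of_injective f (LinearMap.ker_eq_bot.1 h))
  obtain ⟨z, hz, hz0⟩ := Submodule.exists_mem_ne_zero_of_ne_bot hf
  have hz0' : (z : H) ≠ 0 := by simpa using hz0
  have hzV : (z : H) ∈ Vᗮ := by
    have : V.orthogonalProjectionOnto (z : H) = 0 := hz
    simpa using this
  refine ⟨((‖(z : H)‖⁻¹ : ℝ) : ℂ) • (z : H), M.smul_mem _ z.2, Vᗮ.smul_mem _ hzV, ?_⟩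
  rw [norm_smul, Complex.norm_real, Real.norm_of_nonneg (by positivity),
    inv_mul_cancel₀ (norm_ne_zero_iff.2 hz0')]

theorem IsCompactPerturbationAbove.isAN {T : H →L[ℂ] H} (hT : IsSelfAdjoint T) {α : ℝ}
    (hα : 0 ≤ α) (h : IsCompactPerturbationAbove T α) : IsAN T := by
  obtain ⟨hC, V, hV, hpos⟩ := h
  intro M hMc hM
  have : Nontrivial M := Submodule.nontrivial_iff_ne_bot.2 hM
  have : CompleteSpace M := hMc.completeSpace_coe
  by_cases hfin : FiniteDimensional ℂ M
  · exact isNormAttaining_of_finiteDimensional _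
  set S := T ∘L M.subtypeL with hS
  obtain ⟨x, hxM, hxV, hx⟩ := Submodule.exists_mem_orthogonal_norm_eq_one hfin V
  have hTx : α ≤ ‖T x‖ := by
    have h1 := hpos x hxV
    have h2 := re_inner_le_norm (𝕜 := ℂ) (T x) x
    rw [hx] at h1 h2
    linarith
  have hSx : S ⟨x, hxM⟩ = T x := rfl
  have hle : ‖T x‖ ≤ ‖S‖ := by
    have := S.le_opNorm ⟨x, hxM⟩
    rwa [hSx, Submodule.coe_norm, hx, mul_one] at this
  rcases (hTx.trans hle).lt_or_eq with hlt | heq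
  · refine isNormAttaining_of_isCompactOperator S (c := α ^ 2)
      (pow_lt_pow_left₀ hlt hα two_ne_zero) ?_
    -- `T² - α² = (T - α) T + α (T - α)`, compressed to `M`.
    have hcomp : ContinuousLinearMap.adjoint S ∘L S -
        ((α ^ 2 : ℝ) : ℂ) • ContinuousLinearMap.id ℂ M =
        M.orthogonalProjectionOnto ∘L
          ((T - (α : ℂ) • ContinuousLinearMap.id ℂ H) ∘L T +
            (α : ℂ) • (T - (α : ℂ) • ContinuousLinearMap.id ℂ H)) ∘L M.subtypeL := by
      have : ContinuousLinearMap.adjoint S = M.orthogonalProjectionOnto ∘L T := by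
        rw [hS, ContinuousLinearMap.adjoint_comp, hT.adjoint_eq, Submodule.adjoint_subtypeL]
      ext z
      rw [this]
      simp [hS, mul_smul, smul_sub, pow_two]
    rw [hcomp]
    exact (((hC.comp_clm T).add (hC.smul (α : ℂ))).comp_clm M.subtypeL).clm_comp
      M.orthogonalProjectionOnto
  · exact ⟨⟨x, hxM⟩, hx, le_antisymm hle (heq ▸ hTx)⟩

/-! ### Eigenvectors of positive AN-operators -/

/-- On a nonzero closed subspace, an AN-operator attains its norm at a unit vector `y` that is an
eigenvector, in the weak sense, of the compression of `T† T`. -/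
theorem AbsNormAttaining.IsAN.exists_inner_map_map_eq {T : H →L[ℂ] H} (hT : IsAN T)
    {M : Submodule ℂ H} (hMc : IsClosed (M : Set H)) (hM : M ≠ ⊥) :
    ∃ y ∈ M, ‖y‖ = 1 ∧ (∀ z ∈ M, ‖T z‖ ≤ ‖T y‖ * ‖z‖) ∧
      ∀ z ∈ M, ⟪T y, T z⟫_ℂ = ((‖T y‖ ^ 2 : ℝ) : ℂ) * ⟪y, z⟫_ℂ := by
  have : CompleteSpace M := hMc.completeSpace_coe
  obtain ⟨y, hy, hyT⟩ := hT M hMc hM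
  have hyT' : ‖T y‖ = ‖T ∘L M.subtypeL‖ := hyT
  refine ⟨y, y.2, hy, fun z hz => ?_, fun z hz => ?_⟩
  · rw [hyT']
    exact (T ∘L M.subtypeL).le_opNorm ⟨z, hz⟩
  · rw [hyT']
    exact inner_map_map_of_norm_attained (T ∘L M.subtypeL) hy hyT ⟨z, hz⟩

/-- If the images of an orthonormal family under an AN-operator are pairwise orthogonal, their
norms have a largest member. Otherwise no vector of the closed span of the family could attain the
norm there, since it would be orthogonal to every member. -/
theorem AbsNormAttaining.IsAN.exists_norm_apply_le {T : H →L[ℂ] H} (hT : IsAN T)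
    {ι : Type*} [Nonempty ι] {v : ι → H} (hv : Orthonormal ℂ v)
    (horth : Pairwise fun i j => ⟪T (v i), T (v j)⟫_ℂ = 0) :
    ∃ j, ∀ i, ‖T (v i)‖ ≤ ‖T (v j)‖ := by
  by_contra! hcon
  -- if no member is maximal, the norm on the closed span strictly exceeds every `‖T (v i)‖`
  set M := (Submodule.span ℂ (Set.range v)).topologicalClosure with hMdef
  have hMc : IsClosed (M : Set H) := Submodule.isClosed_topologicalClosure _
  have hvM : ∀ i, v i ∈ M := fun i =>
    Submodule.le_topologicalClosure _ (Submodule.subset_span ⟨i, rfl⟩)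
  have hM : M ≠ ⊥ := fun h => by
    have := hvM (Classical.arbitrary ι)
    rw [h, Submodule.mem_bot] at this
    exact hv.ne_zero _ this
  obtain ⟨y, hyM, hy, hle, hinner⟩ := hT.exists_inner_map_map_eq hMc hM
  have hlt : ∀ i, ‖T (v i)‖ < ‖T y‖ := fun i => by
    obtain ⟨k, hk⟩ := hcon i
    have := hle _ (hvM k)
    rw [hv.1 k, mul_one] at this
    exact hk.trans_le this
  -- the sesquilinear identity holds on the family, hence on its closed span
  have hexp : ∀ i, ∀ z ∈ M,
      ⟪T (v i), T z⟫_ℂ = ((‖T (v i)‖ ^ 2 : ℝ) : ℂ) * ⟪v i, z⟫_ℂ := by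
    intro i z hz
    have hcl : IsClosed {z : H | ⟪T (v i), T z⟫_ℂ = ((‖T (v i)‖ ^ 2 : ℝ) : ℂ) * ⟪v i, z⟫_ℂ} :=
      isClosed_eq (by fun_prop) (by fun_prop)
    refine closure_minimal (fun w hw => ?_) hcl hz
    induction hw using Submodule.span_induction with
    | mem w hw =>
      obtain ⟨j, rfl⟩ := hw
      by_cases hij : i = j
      · subst hij
        simp [inner_self_eq_norm_sq_to_K, hv.1 i]
      · simp [horth hij, hv.2 hij]
    | zero => simp
    | add a b _ _ ha hb =>
      simp only [Set.mem_ofPred_eq] at ha hb ⊢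
      rw [map_add, inner_add_right, inner_add_right, ha, hb, mul_add]
    | smul c a _ ha =>
      simp only [Set.mem_ofPred_eq] at ha ⊢
      rw [map_smul, inner_smul_right, inner_smul_right, ha]
      ring
  have hzero : ∀ i, ⟪v i, y⟫_ℂ = 0 := by
    intro i
    have h1 := hexp i y hyM
    -- `⟪T (v i), T y⟫` is both `‖T (v i)‖² ⟪v i, y⟫` and `‖T y‖² ⟪v i, y⟫`
    have h2 := congrArg (starRingEnd ℂ) (hinner _ (hvM i))
    rw [map_mul, inner_conj_symm, inner_conj_symm, Complex.conj_ofReal, h1] at h2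
    have h3 : (((‖T (v i)‖ ^ 2 : ℝ) : ℂ) - ((‖T y‖ ^ 2 : ℝ) : ℂ)) * ⟪v i, y⟫_ℂ = 0 := by
      rw [sub_mul, h2, sub_self]
    refine (mul_eq_zero.1 h3).resolve_left ?_
    have := pow_lt_pow_left₀ (hlt i) (norm_nonneg _) two_ne_zero
    exact_mod_cast (sub_neg.2 this).ne
  have hyperp : y ∈ Mᗮ := by
    rw [hMdef, Submodule.orthogonal_closure, Submodule.mem_orthogonal]
    intro w hw
    induction hw using Submodule.span_induction with
    | mem w hw => obtain ⟨j, rfl⟩ := hw; exact hzero j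
    | zero => simp
    | add a b _ _ ha hb => rw [inner_add_left, ha, hb, add_zero]
    | smul c a _ ha => rw [inner_smul_left, ha, mul_zero]
  have h0 : y = 0 := inner_self_eq_zero.1 (hyperp y hyM)
  rw [h0, norm_zero] at hy
  exact zero_ne_one hy

/-- For positive `T` and invariant `M`, the norm-attaining vector satisfies `T² y = ‖T y‖² y`, and
positivity improves this to `T y = ‖T y‖ y`. -/
theorem AbsNormAttaining.IsAN.exists_eigenvector {T : H →L[ℂ] H} (hT : IsAN T)
    (hpos : T.IsPositive) {M : Submodule ℂ H} (hMc : IsClosed (M : Set H)) (hM : M ≠ ⊥)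
    (hinv : ∀ z ∈ M, T z ∈ M) :
    ∃ y ∈ M, ‖y‖ = 1 ∧ T y = ((‖T y‖ : ℝ) : ℂ) • y := by
  obtain ⟨y, hyM, hy, -, hinner⟩ := hT.exists_inner_map_map_eq hMc hM
  refine ⟨y, hyM, hy, ?_⟩
  set N := ‖T y‖ with hN
  have hsymm : ∀ u w : H, ⟪T u, w⟫_ℂ = ⟪u, T w⟫_ℂ := fun u w => hpos.isSymmetric u w
  have hTT : T (T y) = ((N ^ 2 : ℝ) : ℂ) • y := by
    set d := T (T y) - ((N ^ 2 : ℝ) : ℂ) • y with hd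
    have hdM : d ∈ M := M.sub_mem (hinv _ (hinv _ hyM)) (M.smul_mem _ hyM)
    have : ⟪d, d⟫_ℂ = 0 := by
      conv_lhs => rw [hd]
      rw [inner_sub_left, hsymm (T y) d, hinner d hdM, inner_smul_left, Complex.conj_ofReal,
        sub_self]
    exact sub_eq_zero.1 (inner_self_eq_zero.1 this)
  rcases (norm_nonneg (T y)).eq_or_lt with h0 | hlt
  · have : T y = 0 := norm_eq_zero.1 h0.symm
    simp [hN, this]
  · -- `(T + N) (T - N) y = 0`, and `T + N` is injective because `N > 0`
    set w := T y - (N : ℂ) • y with hw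
    have hTw : T w = -((N : ℂ) • w) := by
      rw [hw, map_sub, hTT, map_smul, Complex.ofReal_pow, pow_two]
      module
    have h1 := hpos.re_inner_nonneg_left w
    rw [hTw, inner_neg_left, inner_smul_left, Complex.conj_ofReal, inner_self_eq_norm_sq_to_K] at h1
    have h2 : RCLike.re (-((N : ℂ) * ((‖w‖ : ℂ) ^ 2))) = -(N * ‖w‖ ^ 2) := by
      rw [← Complex.ofReal_pow, ← Complex.ofReal_mul, ← Complex.ofReal_neg]
      exact Complex.ofReal_re _
    erw [h2] at h1
    have h3 : ‖w‖ ^ 2 ≤ 0 := by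
      by_contra! h
      nlinarith [mul_pos hlt h]
    have h4 : w = 0 := norm_eq_zero.1 (pow_eq_zero_iff two_ne_zero |>.1
      (le_antisymm h3 (sq_nonneg _)))
    exact sub_eq_zero.1 h4

/-- A positive AN-operator is diagonalizable: the orthogonal complement of a maximal orthonormal
set of eigenvectors is invariant, so it would contain a further eigenvector if it were nonzero. -/
theorem AbsNormAttaining.IsAN.exists_hilbertBasis_eigenvectors {T : H →L[ℂ] H} (hT : IsAN T)
    (hpos : T.IsPositive) :
    ∃ (s : Set H) (b : HilbertBasis s ℂ H), ∀ i, T (b i) = ((‖T (b i)‖ : ℝ) : ℂ) • b i := by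
  obtain ⟨s, hs⟩ := zorn_subset {s : Set H | Orthonormal ℂ (Subtype.val : s → H) ∧
      ∀ x ∈ s, T x = ((‖T x‖ : ℝ) : ℂ) • x} fun c hc hchain =>
    ⟨⋃₀ c, ⟨orthonormal_sUnion_of_directed hchain.directedOn fun x hx => (hc hx).1,
      fun x ⟨t, ht, hxt⟩ => (hc ht).2 x hxt⟩, fun t ht => Set.subset_sUnion_of_mem ht⟩
  obtain ⟨horth, heig⟩ := hs.prop
  have hperp : (Submodule.span ℂ s)ᗮ = ⊥ := by
    by_contra hne
    obtain ⟨y, hyM, hy, hTy⟩ := hT.exists_eigenvector hpos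
      (Submodule.isClosed_orthogonal _) hne (by
        intro z hz
        rw [Submodule.mem_orthogonal] at hz ⊢
        intro u hu
        have hTu : T u ∈ Submodule.span ℂ s := by
          induction hu using Submodule.span_induction with
          | mem w hw => rw [heig w hw]; exact Submodule.smul_mem _ _ (Submodule.subset_span hw)
          | zero => simp
          | add a b _ _ ha hb => rw [map_add]; exact Submodule.add_mem _ ha hb
          | smul c a _ ha => rw [map_smul]; exact Submodule.smul_mem _ _ ha
        exact (hpos.isSymmetric u z).symm.trans (hz _ hTu))
    have hys : y ∉ s := fun h => by
      have := inner_self_eq_zero.1 (hyM y (Submodule.subset_span h))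
      rw [this, norm_zero] at hy
      exact zero_ne_one hy
    classical
    have hins : Orthonormal ℂ (Subtype.val : ↥(insert y s) → H) := by
      have h := (orthonormal_subtype_iff_ite (𝕜 := ℂ) (E := H) (s := s)).1 horth
      rw [orthonormal_subtype_iff_ite]
      have hyu : ∀ u ∈ s, ⟪u, y⟫_ℂ = 0 := fun u hu => hyM u (Submodule.subset_span hu)
      rintro a (rfl | ha) b (rfl | hb)
      · simp [inner_self_eq_norm_sq_to_K, hy]
      · rw [← inner_conj_symm, hyu b hb, if_neg (by rintro rfl; exact hys hb), map_zero]
      · rw [hyu a ha, if_neg (by rintro rfl; exact hys ha)]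
      · exact h a ha b hb
    exact hys (hs.le_of_ge ⟨hins, by
      rintro x (rfl | hx)
      · exact hTy
      · exact heig x hx⟩ (Set.subset_insert _ _) (Set.mem_insert _ _))
  refine ⟨s, HilbertBasis.mkOfOrthogonalEqBot horth (by simpa using hperp), fun i => ?_⟩
  rw [HilbertBasis.coe_mkOfOrthogonalEqBot]
  exact heig i i.2

/-- The eigenvalues of a positive AN-operator have at most one accumulation point, counted with
multiplicity. Otherwise, mixing eigenvectors of eigenvalues at most `a` with eigenvectors of
eigenvalues at least `b` produces an orthonormal sequence with orthogonal images of strictly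
increasing norms. -/
theorem AbsNormAttaining.IsAN.finite_le_or_finite_ge {T : H →L[ℂ] H} (hT : IsAN T)
    {ι : Type*} {e : ι → H} (he : Orthonormal ℂ e) {l : ι → ℝ} (hl : ∀ i, 0 ≤ l i)
    (heig : ∀ i, T (e i) = (l i : ℂ) • e i) {a b : ℝ} (hab : a < b) :
    {i | l i ≤ a}.Finite ∨ {i | b ≤ l i}.Finite := by
  by_contra! hcon
  obtain ⟨h₁, h₂⟩ := hcon
  set f : ℕ → ι := fun n => (h₁.natEmbedding _ n : ι) with hf
  set g : ℕ → ι := fun n => (h₂.natEmbedding _ n : ι) with hg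
  have hfa : ∀ n, l (f n) ≤ a := fun n => (h₁.natEmbedding _ n).2
  have hgb : ∀ n, b ≤ l (g n) := fun n => (h₂.natEmbedding _ n).2
  have hfi : Function.Injective f := Subtype.val_injective.comp (h₁.natEmbedding _).injective
  have hgi : Function.Injective g := Subtype.val_injective.comp (h₂.natEmbedding _).injective
  have hfg : ∀ m n, f m ≠ g n := fun m n h => by
    have := hfa m; rw [h] at this; linarith [hgb n]
  have ha : 0 ≤ a := (hl _).trans (hfa 0)
  -- the prescribed squared norms, strictly increasing in `(a², b²)`
  set t : ℕ → ℝ := fun n => b ^ 2 - (b ^ 2 - a ^ 2) * (1 / ((n : ℝ) + 1)) with ht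
  have hab2 : a ^ 2 < b ^ 2 := pow_lt_pow_left₀ hab ha two_ne_zero
  have hta : ∀ n, a ^ 2 ≤ t n := fun n => by
    have : 1 / ((n : ℝ) + 1) ≤ 1 := by
      rw [div_le_one (by positivity)]; linarith [n.cast_nonneg (α := ℝ)]
    simp only [ht]
    nlinarith
  have htb : ∀ n, t n ≤ b ^ 2 := fun n => by
    have : 0 < 1 / ((n : ℝ) + 1) := by positivity
    simp only [ht]
    nlinarith
  have htmono : ∀ n, t n < t (n + 1) := fun n => by
    have : 1 / (((n + 1 : ℕ) : ℝ) + 1) < 1 / ((n : ℝ) + 1) := by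
      apply one_div_lt_one_div_of_lt (by positivity)
      push_cast; linarith
    simp only [ht]
    nlinarith
  have hmix : ∀ n, ∃ c s : ℝ, c ^ 2 + s ^ 2 = 1 ∧
      c ^ 2 * l (f n) ^ 2 + s ^ 2 * l (g n) ^ 2 = t n := by
    intro n
    have hf2 : l (f n) ^ 2 ≤ a ^ 2 := pow_le_pow_left₀ (hl _) (hfa n) 2
    have hg2 : b ^ 2 ≤ l (g n) ^ 2 := pow_le_pow_left₀ (ha.trans hab.le) (hgb n) 2
    have hd : 0 < l (g n) ^ 2 - l (f n) ^ 2 := by linarith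
    have h1 : 0 ≤ (t n - l (f n) ^ 2) / (l (g n) ^ 2 - l (f n) ^ 2) :=
      div_nonneg (by linarith [hta n]) hd.le
    have h2 : 0 ≤ (l (g n) ^ 2 - t n) / (l (g n) ^ 2 - l (f n) ^ 2) :=
      div_nonneg (by linarith [htb n]) hd.le
    refine ⟨√((l (g n) ^ 2 - t n) / (l (g n) ^ 2 - l (f n) ^ 2)),
      √((t n - l (f n) ^ 2) / (l (g n) ^ 2 - l (f n) ^ 2)), ?_, ?_⟩
    · rw [Real.sq_sqrt h1, Real.sq_sqrt h2]; field_simp; ring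
    · rw [Real.sq_sqrt h1, Real.sq_sqrt h2]; field_simp; ring
  choose c s hcs hcst using hmix
  classical
  have hin := orthonormal_iff_ite.1 he
  have key : ∀ (p q p' q' : ℝ) (m n : ℕ),
      ⟪(p : ℂ) • e (f m) + (q : ℂ) • e (g m), (p' : ℂ) • e (f n) + (q' : ℂ) • e (g n)⟫_ℂ =
        if m = n then ((p * p' + q * q' : ℝ) : ℂ) else 0 := by
    intro p q p' q' m n
    have h1 : (f m = f n) = (m = n) := propext hfi.eq_iff
    have h2 : (g m = g n) = (m = n) := propext hgi.eq_iff
    simp only [inner_add_left, inner_add_right, inner_smul_left, inner_smul_right, hin,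
      Complex.conj_ofReal, h1, h2, hfg, (hfg _ _).symm, if_false, mul_zero, add_zero, zero_add]
    split_ifs
    · push_cast; ring
    · simp
  set v : ℕ → H := fun n => (c n : ℂ) • e (f n) + (s n : ℂ) • e (g n) with hv
  have hTv : ∀ n, T (v n) = ((c n * l (f n) : ℝ) : ℂ) • e (f n) +
      ((s n * l (g n) : ℝ) : ℂ) • e (g n) := fun n => by
    simp only [hv, map_add, map_smul, heig, smul_smul, Complex.ofReal_mul]
  have hvo : Orthonormal ℂ v := by
    rw [orthonormal_iff_ite]
    intro m n
    rw [hv, key]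
    split_ifs with h
    · subst h
      rw [← pow_two, ← pow_two, hcs]; simp
    · rfl
  have hnorm : ∀ n, ‖T (v n)‖ ^ 2 = t n := fun n => by
    have h := inner_self_eq_norm_sq_to_K (𝕜 := ℂ) (T (v n))
    rw [hTv, key, if_pos rfl, ← hTv] at h
    have h' : c n * l (f n) * (c n * l (f n)) + s n * l (g n) * (s n * l (g n)) =
      ‖T (v n)‖ ^ 2 :=
      Complex.ofReal_injective (by rw [h]; push_cast; rfl)
    rw [← h', ← hcst n]; ring
  obtain ⟨j, hj⟩ := hT.exists_norm_apply_le hvo fun m n hmn => by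
    change ⟪T (v m), T (v n)⟫_ℂ = 0
    rw [hTv, hTv, key, if_neg hmn]
  have := pow_le_pow_left₀ (norm_nonneg _) (hj (j + 1)) 2
  rw [hnorm, hnorm] at this
  exact (htmono j).not_ge this

/-! ### The structure of positive AN-operators -/

omit [CompleteSpace H] in
theorem HilbertBasis.hasSum_norm_inner_sq {ι : Type*} (b : HilbertBasis ι ℂ H) (x : H) :
    HasSum (fun i => ‖⟪b i, x⟫_ℂ‖ ^ 2) (‖x‖ ^ 2) := by
  have h := (b.hasSum_inner_mul_inner x x).mapL Complex.reCLM
  have h2 : Complex.reCLM ⟪x, x⟫_ℂ = ‖x‖ ^ 2 := inner_self_eq_norm_sq (𝕜 := ℂ) x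
  rw [h2] at h
  convert h using 2 with i
  rw [← inner_conj_symm x (b i), Complex.conj_mul', ← Complex.ofReal_pow]
  rfl

/-- A diagonal operator with real entries tending to zero is compact. -/
theorem isCompactOperator_of_diagonal {ι : Type*} (b : HilbertBasis ι ℂ H) {C : H →L[ℂ] H}
    {d : ι → ℝ} (hC : ∀ x i, ⟪b i, C x⟫_ℂ = (d i : ℂ) * ⟪b i, x⟫_ℂ)
    (hd : ∀ ε > 0, {i | ε ≤ |d i|}.Finite) : IsCompactOperator C := by
  suffices h : C ∈ closure {D : H →L[ℂ] H | IsCompactOperator D} by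
    rwa [isClosed_setOfPred_isCompactOperator.closure_eq] at h
  rw [Metric.mem_closure_iff]
  intro ε hε
  set J := {i | ε / 2 ≤ |d i|} with hJ
  set W := Submodule.span ℂ (b '' J) with hW
  have : FiniteDimensional ℂ W := FiniteDimensional.span_of_finite ℂ ((hd _ (half_pos hε)).image b)
  refine ⟨C ∘L W.subtypeL ∘L W.orthogonalProjectionOnto, ?_, ?_⟩
  · have : ProperSpace W := FiniteDimensional.proper ℂ W
    have h : IsCompactOperator W.orthogonalProjectionOnto :=
      isCompactOperator_of_locallyCompactSpace_dom W.orthogonalProjectionOnto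
    exact h.clm_comp (C ∘L W.subtypeL)
  · rw [dist_eq_norm]
    refine lt_of_le_of_lt (ContinuousLinearMap.opNorm_le_bound _ (half_pos hε).le fun x => ?_)
      (half_lt_self hε)
    -- the error is `C w` with `w ⊥ b i` for `i ∈ J`, and the remaining entries are below `ε / 2`
    set w := x - W.starProjection x with hw
    have hwW : w ∈ Wᗮ := Submodule.sub_starProjection_mem_orthogonal x
    have hwx : ‖w‖ ≤ ‖x‖ := by
      have : w = Wᗮ.starProjection x := by
        rw [hw, Submodule.starProjection_orthogonal']; simp
      rw [this]
      exact Submodule.norm_starProjection_apply_le _ x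
    have hCw : (C - C ∘L W.subtypeL ∘L W.orthogonalProjectionOnto) x = C w := by
      simp [hw]
    rw [hCw]
    have hle : ‖C w‖ ^ 2 ≤ (ε / 2) ^ 2 * ‖w‖ ^ 2 := by
      refine hasSum_le (fun i => ?_) (b.hasSum_norm_inner_sq (C w))
        ((b.hasSum_norm_inner_sq w).mul_left ((ε / 2) ^ 2))
      rw [hC, norm_mul, mul_pow, Complex.norm_real, Real.norm_eq_abs]
      by_cases hi : i ∈ J
      · rw [hwW (b i) (Submodule.subset_span ⟨i, hi, rfl⟩)]
        simp
      · have : |d i| < ε / 2 := not_le.1 hi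
        gcongr
    rw [← mul_pow] at hle
    have := abs_le_of_sq_le_sq' hle (by positivity)
    exact this.2.trans (by gcongr)

/-- The structure theorem for positive AN-operators, in the direction that extracts the essential
value `α` as the single accumulation point of the eigenvalues. -/
theorem AbsNormAttaining.IsAN.exists_isCompactPerturbationAbove {T : H →L[ℂ] H} (hT : IsAN T)
    (hpos : T.IsPositive) (hH : ¬ FiniteDimensional ℂ H) :
    ∃ α : ℝ, 0 ≤ α ∧ IsCompactPerturbationAbove T α := by
  obtain ⟨s, b, heig⟩ := hT.exists_hilbertBasis_eigenvectors hpos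
  set l : s → ℝ := fun i => ‖T (b i)‖ with hl
  have hl0 : ∀ i, 0 ≤ l i := fun i => norm_nonneg _
  have hlT : ∀ i, l i ≤ ‖T‖ := fun i => by
    simpa [b.orthonormal.1 i] using T.le_opNorm (b i)
  have hsinf : Infinite s := by
    by_contra hfin
    rw [not_infinite_iff_finite] at hfin
    have := Fintype.ofFinite s
    exact hH (b.toOrthonormalBasis.toBasis.finiteDimensional_of_finite)
  -- `α` is the upper limit of the eigenvalues: only finitely many exceed any `c > α`
  set B := {c : ℝ | {i | c ≤ l i}.Infinite} with hB
  have hB0 : (0 : ℝ) ∈ B := by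
    have : {i | 0 ≤ l i} = Set.univ := Set.eq_univ_of_forall hl0
    simpa [hB, this] using Set.infinite_univ
  have hBb : BddAbove B := ⟨‖T‖, fun c hc => by
    obtain ⟨i, hi⟩ := hc.nonempty
    exact le_trans hi (hlT i)⟩
  set α := sSup B with hα
  have hge : ∀ c, α < c → {i | c ≤ l i}.Finite := fun c hc => by
    by_contra h
    exact (le_csSup hBb (show c ∈ B from h)).not_gt hc
  have hle : ∀ c, c < α → {i | l i ≤ c}.Finite := fun c hc => by
    obtain ⟨c', hc'B, hcc'⟩ := exists_lt_of_lt_csSup ⟨0, hB0⟩ hc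
    exact (hT.finite_le_or_finite_ge b.orthonormal hl0 heig hcc').resolve_right hc'B
  have hin : ∀ x i, ⟪b i, T x⟫_ℂ = (l i : ℂ) * ⟪b i, x⟫_ℂ := fun x i => by
    have : ⟪T (b i), x⟫_ℂ = ⟪b i, T x⟫_ℂ := hpos.isSymmetric (b i) x
    rw [← this, heig i, inner_smul_left, Complex.conj_ofReal]
  -- the supremum `α` of an infinite set of smaller eigenvalues would not be attained
  have hJ : {i | l i < α}.Finite := by
    by_contra hinf
    have : Nonempty {i | l i < α} := Set.Infinite.nonempty hinf |>.to_subtype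
    obtain ⟨j, hj⟩ := hT.exists_norm_apply_le (v := fun i : {i | l i < α} => b i)
      (b.orthonormal.comp _ Subtype.val_injective) fun i k hik => by
        change ⟪T (b i), T (b k)⟫_ℂ = 0
        rw [heig i, heig k, inner_smul_left, inner_smul_right,
          b.orthonormal.2 (Subtype.val_injective.ne hik)]
        simp
    exact hinf ((hle (l j) j.2).subset fun i hi => hj ⟨i, hi⟩)
  refine ⟨α, le_csSup hBb hB0, ?_, Submodule.span ℂ (b '' {i | l i < α}),
    FiniteDimensional.span_of_finite ℂ (hJ.image b), fun x hx => ?_⟩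
  · refine isCompactOperator_of_diagonal b (d := fun i => l i - α) (fun x i => ?_) fun ε hε => ?_
    · simp only [sub_apply, smul_apply, ContinuousLinearMap.id_apply,
        inner_sub_right, inner_smul_right, hin, Complex.ofReal_sub]
      ring
    · refine ((hge (α + ε) (by linarith)).union (hle (α - ε) (by linarith))).subset fun i hi => ?_
      rcases le_abs.1 (show ε ≤ |l i - α| from hi) with h | h
      · exact Or.inl (by change α + ε ≤ l i; linarith)
      · exact Or.inr (by change l i ≤ α - ε; linarith)
  · have h1 := (b.hasSum_inner_mul_inner x (T x)).mapL Complex.reCLM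
    have h2 : RCLike.re ⟪T x, x⟫_ℂ = Complex.reCLM ⟪x, T x⟫_ℂ := inner_re_symm (𝕜 := ℂ) _ _
    rw [h2]
    refine hasSum_le (fun i => ?_) ((b.hasSum_norm_inner_sq x).mul_left α) h1
    have h3 : ⟪x, b i⟫_ℂ * ⟪b i, T x⟫_ℂ = ((l i * ‖⟪b i, x⟫_ℂ‖ ^ 2 : ℝ) : ℂ) := by
      rw [hin, mul_left_comm, ← inner_conj_symm x (b i), Complex.conj_mul']
      push_cast; rfl
    rw [h3]
    change α * _ ≤ l i * _
    by_cases hi : l i < α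
    · rw [hx (b i) (Submodule.subset_span ⟨i, hi, rfl⟩)]
      simp
    · have := not_lt.1 hi
      gcongr

/-! ### The essential spectrum -/

omit [CompleteSpace H] in
theorem IsCompactOperator.of_finiteDimensional_range {F : Type*} [NormedAddCommGroup F]
    [InnerProductSpace ℂ F] (f : H →L[ℂ] F) [FiniteDimensional ℂ f.range] :
    IsCompactOperator f := by
  have : ProperSpace f.range := FiniteDimensional.proper ℂ _
  have h := isCompactOperator_of_locallyCompactSpace_dom
    (f.codRestrict f.range fun x => ⟨x, rfl⟩)
  exact h.clm_comp f.range.subtypeL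

omit [CompleteSpace H] in
/-- A quasi-inverse would exhibit the identity as the sum of a compact and a finite-rank operator. -/
theorem IsCompactOperator.not_isFredholm (hH : ¬ FiniteDimensional ℂ H) {C : H →L[ℂ] H}
    (hC : IsCompactOperator C) : ¬ C.IsFredholm := by
  intro hF
  obtain ⟨v, hv, -⟩ := hF.exists_isQuasiInverse
  have hfr : ((v ∘L C : H →L[ℂ] H).toLinearMap - LinearMap.id).HasFiniteRange :=
    LinearMap.FiniteRangeSetoid.equiv_iff_hasFiniteRange.1 hv
  have : FiniteDimensional ℂ (v ∘L C - ContinuousLinearMap.id ℂ H).range :=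
    Submodule.fg_iff_finiteDimensional _ |>.1 hfr.fg_range
  have h1 := IsCompactOperator.of_finiteDimensional_range (v ∘L C - ContinuousLinearMap.id ℂ H)
  have h2 : IsCompactOperator (v ∘L C) := hC.clm_comp v
  refine hH (FiniteDimensional.of_isCompactOperator_id (𝕜 := ℂ) ?_)
  have h3 : (id : H → H) = v ∘L C - (v ∘L C - ContinuousLinearMap.id ℂ H) := by
    funext x
    simp
  rw [h3]
  exact h2.sub h1

/-- On the orthogonal complement of its finite-dimensional kernel, `C - ν` is invertible by the
Fredholm alternative. -/
theorem IsCompactOperator.isFredholm_sub_smul {C : H →L[ℂ] H} (hC : IsCompactOperator C)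
    (hs : IsSelfAdjoint C) {ν : ℂ} (hν : ν ≠ 0) :
    (C - ν • ContinuousLinearMap.id ℂ H).IsFredholm := by
  set D := C - ν • ContinuousLinearMap.id ℂ H with hD
  have hDx : ∀ x, D x = C x - ν • x := fun x => by simp [hD]
  set K := D.ker with hK
  have hKc : IsClosed (K : Set H) := D.isClosed_ker
  have hKeig : ∀ x ∈ K, C x = ν • x := fun x hx => by
    have : D x = 0 := hx
    rwa [hDx, sub_eq_zero] at this
  have hKfin : FiniteDimensional ℂ K := by
    refine FiniteDimensional.of_isCompactOperator_id (𝕜 := ℂ) ?_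
    have h1 : IsCompactOperator (C ∘L K.subtypeL) := hC.comp_clm K.subtypeL
    have h2 := (h1.codRestrict (V := K) (fun x => by
      change C x ∈ K
      rw [hKeig x x.2]; exact K.smul_mem _ x.2) hKc).smul (ν⁻¹)
    refine (congrArg IsCompactOperator (funext fun x => Subtype.ext ?_)).mpr h2
    simp [hKeig x x.2, smul_smul, hν]
  have hinvC : ∀ x ∈ Kᗮ, C x ∈ Kᗮ := fun x hx u hu => by
    rw [← ContinuousLinearMap.adjoint_inner_left, hs.adjoint_eq, hKeig u hu, inner_smul_left,
      hx u hu, mul_zero]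
  have hmaps : Set.MapsTo D Kᗮ Kᗮ := fun x hx => by
    rw [hDx]; exact Kᗮ.sub_mem (hinvC x hx) (Kᗮ.smul_mem _ hx)
  have : CompleteSpace Kᗮ := (Submodule.isClosed_orthogonal K).completeSpace_coe
  set R : Kᗮ →L[ℂ] Kᗮ := C.restrict hinvC with hR
  have hRx : ∀ x : Kᗮ, (R x : H) = C x := fun x => rfl
  have hRc : IsCompactOperator R :=
    IsCompactOperator.codRestrict (V := Kᗮ) (hC.comp_clm Kᗮ.subtypeL) (fun x => hinvC x x.2)
      (Submodule.isClosed_orthogonal K)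
  have hbij : Function.Bijective (R - ν • (1 : Kᗮ →L[ℂ] Kᗮ)) := by
    rcases hRc.hasEigenvalue_or_mem_resolventSet hν with h | h
    · obtain ⟨x, hx, hx0⟩ := h.exists_hasEigenvector
      refine absurd ?_ hx0
      have h1 : R x = ν • x := Module.End.mem_eigenspace_iff.1 hx
      have h2 : (x : H) ∈ K := by
        change D x = 0
        rw [hDx, ← hRx, h1]; simp
      exact Subtype.ext (inner_self_eq_zero.1 (x.2 _ h2))
    · rw [spectrum.mem_resolventSet_iff, ← IsUnit.neg_iff,
        ContinuousLinearMap.isUnit_iff_bijective] at h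
      convert h
      ext x
      simp [Algebra.algebraMap_eq_smul_one]
  have hDR : D.restrict hmaps = R - ν • (1 : Kᗮ →L[ℂ] Kᗮ) := by
    ext x
    exact hDx x
  have hco : Kᗮ.CoFG :=
    Submodule.FG.cofg_of_isCompl (Submodule.isCompl_orthogonal (K := K))
      (Submodule.fg_iff_finiteDimensional _ |>.2 hKfin)
  refine ContinuousLinearMap.IsFredholm.of_isInvertible_restrict
    (Submodule.isClosed_orthogonal K) (Submodule.isClosed_orthogonal K) hmaps ?_
  rw [hDR]
  exact ⟨ContinuousLinearEquiv.ofBijective _ (LinearMap.ker_eq_bot.2 hbij.1)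
    (LinearMap.range_eq_top.2 hbij.2), by ext; rfl⟩

/-- A self-adjoint compact perturbation of a real scalar has that scalar as its only essential
spectral value. -/
theorem AbsNormAttaining.essentialSpectrum_eq_singleton (hH : ¬ FiniteDimensional ℂ H)
    {T : H →L[ℂ] H} (hT : IsSelfAdjoint T) {α : ℝ}
    (hC : IsCompactOperator (T - (α : ℂ) • ContinuousLinearMap.id ℂ H)) :
    essentialSpectrum T = {(α : ℂ)} := by
  ext μ
  rw [Set.mem_singleton_iff]
  constructor
  · intro hμ
    by_contra hne
    refine hμ ?_
    have hs : IsSelfAdjoint (T - (α : ℂ) • ContinuousLinearMap.id ℂ H) := by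
      refine hT.sub ?_
      rw [IsSelfAdjoint, star_smul]
      congr 1
      · exact Complex.conj_ofReal α
      · exact star_one (H →L[ℂ] H)
    have h := hC.isFredholm_sub_smul hs (sub_ne_zero.2 hne)
    convert h using 1
    ext x
    simp [sub_smul]
  · rintro rfl
    exact hC.not_isFredholm hH

end PositiveOperators

/-! ### Block operators -/

section BlockOperator

variable {H₁ : Type*} [NormedAddCommGroup H₁] [InnerProductSpace ℂ H₁] [CompleteSpace H₁]
  {H₂ : Type*} [NormedAddCommGroup H₂] [InnerProductSpace ℂ H₂] [CompleteSpace H₂]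

variable (H₁ H₂) in
/-- The isometric inclusion of the first summand into `H₁ ⊕ H₂`. -/
noncomputable def WithLp.inlL₂ : H₁ →L[ℂ] WithLp 2 (H₁ × H₂) :=
  (WithLp.prodContinuousLinearEquiv 2 ℂ H₁ H₂).symm.toContinuousLinearMap ∘L
    ContinuousLinearMap.inl ℂ H₁ H₂

variable (H₁ H₂) in
/-- The isometric inclusion of the second summand into `H₁ ⊕ H₂`. -/
noncomputable def WithLp.inrL₂ : H₂ →L[ℂ] WithLp 2 (H₁ × H₂) :=
  (WithLp.prodContinuousLinearEquiv 2 ℂ H₁ H₂).symm.toContinuousLinearMap ∘L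
    ContinuousLinearMap.inr ℂ H₁ H₂

omit [CompleteSpace H₁] [CompleteSpace H₂] in
theorem WithLp.inlL₂_apply (x : H₁) : WithLp.inlL₂ H₁ H₂ x = WithLp.toLp 2 (x, 0) := rfl

omit [CompleteSpace H₁] [CompleteSpace H₂] in
theorem WithLp.inrL₂_apply (y : H₂) : WithLp.inrL₂ H₁ H₂ y = WithLp.toLp 2 (0, y) := rfl

theorem AbsNormAttaining.re_inner_blockOperator_id (X : H₂ →L[ℂ] H₁) (A : H₂ →L[ℂ] H₂)
    (x : H₁) (y : H₂) :
    RCLike.re ⟪blockOperator (ContinuousLinearMap.id ℂ H₁) X (ContinuousLinearMap.adjoint X) A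
      (WithLp.toLp 2 (x, y)), WithLp.toLp 2 (x, y)⟫_ℂ =
      ‖x‖ ^ 2 + 2 * RCLike.re ⟪X y, x⟫_ℂ + RCLike.re ⟪A y, y⟫_ℂ := by
  rw [blockOperator_apply, WithLp.prod_inner_apply]
  simp only [ContinuousLinearMap.id_apply, inner_add_left, map_add,
    ContinuousLinearMap.adjoint_inner_left]
  change RCLike.re ⟪x, x⟫_ℂ + RCLike.re ⟪X y, x⟫_ℂ +
    (RCLike.re ⟪x, X y⟫_ℂ + RCLike.re ⟪A y, y⟫_ℂ) = _
  rw [inner_re_symm x (X y), inner_self_eq_norm_sq]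
  ring

omit [InnerProductSpace ℂ H₁] [CompleteSpace H₁] [InnerProductSpace ℂ H₂] [CompleteSpace H₂] in
theorem WithLp.norm_sq_toLp_prod (x : H₁) (y : H₂) :
    ‖(WithLp.toLp 2 (x, y) : WithLp 2 (H₁ × H₂))‖ ^ 2 = ‖x‖ ^ 2 + ‖y‖ ^ 2 :=
  WithLp.prod_norm_sq_eq_of_L2 _

/-- Compressing to the two diagonal corners identifies the essential value as `1` and passes the
structure on to `A`. For `X`: the quadratic form of `T - 1` has no `H₁`-part, so its nonnegativity
on a subspace of finite codimension forces the cross term `⟪X y, x⟫` to vanish there. -/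
theorem AbsNormAttaining.of_isCompactPerturbationAbove_blockOperator
    (hH₁ : ¬ FiniteDimensional ℂ H₁) {A : H₂ →L[ℂ] H₂} {X : H₂ →L[ℂ] H₁} {α : ℝ}
    (h : IsCompactPerturbationAbove (blockOperator (ContinuousLinearMap.id ℂ H₁) X
      (ContinuousLinearMap.adjoint X) A) α) :
    IsCompactPerturbationAbove A 1 ∧ FiniteDimensional ℂ X.range := by
  obtain ⟨hC, V, hV, hpos⟩ := h
  set D := blockOperator (ContinuousLinearMap.id ℂ H₁) X (ContinuousLinearMap.adjoint X) A -
    (α : ℂ) • ContinuousLinearMap.id ℂ (WithLp 2 (H₁ × H₂)) with hD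
  have hα : α = 1 := by
    by_contra hne
    have hne' : (1 - (α : ℂ)) ≠ 0 := by
      rw [sub_ne_zero]; exact_mod_cast Ne.symm hne
    refine hH₁ (FiniteDimensional.of_isCompactOperator_id (𝕜 := ℂ) ?_)
    have h1 := ((hC.comp_clm (WithLp.inlL₂ H₁ H₂)).clm_comp (WithLp.fstL 2 ℂ H₁ H₂)).smul
      (1 - (α : ℂ))⁻¹
    refine (congrArg IsCompactOperator (funext fun x => ?_)).mpr h1
    have h2 : (WithLp.fstL 2 ℂ H₁ H₂) (D (WithLp.inlL₂ H₁ H₂ x)) = (1 - (α : ℂ)) • x := by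
      simp [hD, WithLp.inlL₂_apply, blockOperator_apply, sub_smul]
    change x = (1 - (α : ℂ))⁻¹ • (WithLp.fstL 2 ℂ H₁ H₂) (D (WithLp.inlL₂ H₁ H₂ x))
    rw [h2, smul_smul, inv_mul_cancel₀ hne', one_smul]
  subst hα
  set V₁ := V.map (WithLp.fstL 2 ℂ H₁ H₂).toLinearMap with hV₁
  set V₂ := V.map (WithLp.sndL 2 ℂ H₁ H₂).toLinearMap with hV₂
  have hform : ∀ x ∈ V₁ᗮ, ∀ y ∈ V₂ᗮ,
      ‖y‖ ^ 2 ≤ 2 * RCLike.re ⟪X y, x⟫_ℂ + RCLike.re ⟪A y, y⟫_ℂ := by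
    intro x hx y hy
    have := hpos (WithLp.toLp 2 (x, y)) fun u hu => by
      rw [WithLp.prod_inner_apply]
      have h1 : ⟪u.fst, x⟫_ℂ = 0 := hx _ ⟨u, hu, rfl⟩
      have h2 : ⟪u.snd, y⟫_ℂ = 0 := hy _ ⟨u, hu, rfl⟩
      exact (congrArg₂ (· + ·) h1 h2).trans (add_zero 0)
    rw [re_inner_blockOperator_id, WithLp.norm_sq_toLp_prod] at this
    linarith
  refine ⟨⟨?_, V₂, inferInstance, fun y hy => ?_⟩, ?_⟩
  · have h1 := (hC.comp_clm (WithLp.inrL₂ H₁ H₂)).clm_comp (WithLp.sndL 2 ℂ H₁ H₂)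
    refine (congrArg IsCompactOperator (funext fun y => ?_)).mpr h1
    change _ = (WithLp.sndL 2 ℂ H₁ H₂) (D (WithLp.inrL₂ H₁ H₂ y))
    simp [hD, WithLp.inrL₂_apply, blockOperator_apply]
  · simpa using hform 0 (Submodule.zero_mem _) y hy
  · have hXV : ∀ y ∈ V₂ᗮ, X y ∈ V₁ := by
      intro y hy
      set w := V₁ᗮ.starProjection (X y) with hw
      have hwV : w ∈ V₁ᗮ := Submodule.starProjection_apply_mem _ _
      have hin : RCLike.re ⟪X y, w⟫_ℂ = ‖w‖ ^ 2 := by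
        have h1 : ⟪X y - w, w⟫_ℂ = 0 := Submodule.starProjection_inner_eq_zero _ _ hwV
        rw [inner_sub_left, sub_eq_zero] at h1
        rw [h1, inner_self_eq_norm_sq]
      have hw0 : w = 0 := by
        by_contra hne
        have hpos' : 0 < ‖w‖ ^ 2 := by have := norm_pos_iff.2 hne; positivity
        set q := RCLike.re ⟪A y, y⟫_ℂ - ‖y‖ ^ 2 with hq
        -- for this multiple of `w` the form inequality reads `0 ≤ -(q + 1) + q`
        have h1 := hform ((-(((q + 1) / (2 * ‖w‖ ^ 2) : ℝ) : ℂ)) • w)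
          (Submodule.smul_mem _ _ hwV) y hy
        rw [← Complex.ofReal_neg, inner_smul_right] at h1
        have h2 : RCLike.re (((-((q + 1) / (2 * ‖w‖ ^ 2)) : ℝ) : ℂ) * ⟪X y, w⟫_ℂ) =
            -((q + 1) / (2 * ‖w‖ ^ 2)) * RCLike.re ⟪X y, w⟫_ℂ := Complex.re_ofReal_mul _ _
        rw [h2, hin] at h1
        have h3 : 2 * (-((q + 1) / (2 * ‖w‖ ^ 2)) * ‖w‖ ^ 2) = -(q + 1) := by
          field_simp
        rw [h3] at h1
        linarith
      have h2 := Submodule.starProjection_orthogonal_val (K := V₁) (X y)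
      rw [← hw, hw0] at h2
      rw [sub_eq_zero.1 h2.symm]
      exact Submodule.starProjection_apply_mem _ _
    refine Submodule.finiteDimensional_of_le (S₂ := V₁ ⊔ V₂.map X.toLinearMap) ?_
    rintro _ ⟨y, rfl⟩
    have hy : X y = X (y - V₂.starProjection y) + X (V₂.starProjection y) := by
      rw [← map_add, sub_add_cancel]
    change X y ∈ _
    rw [hy]
    exact Submodule.add_mem_sup (hXV _ (Submodule.sub_starProjection_mem_orthogonal y))
      ⟨_, Submodule.starProjection_apply_mem _ _, rfl⟩

theorem IsCompactOperator.adjoint_of_finiteDimensional_range (X : H₂ →L[ℂ] H₁)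
    [FiniteDimensional ℂ X.range] : IsCompactOperator (ContinuousLinearMap.adjoint X) := by
  have : ProperSpace X.range := FiniteDimensional.proper ℂ _
  have h1 : X = X.range.subtypeL ∘L X.codRestrict X.range fun y => ⟨y, rfl⟩ := rfl
  have h2 : IsCompactOperator (ContinuousLinearMap.adjoint X.range.subtypeL) :=
    isCompactOperator_of_locallyCompactSpace_dom (ContinuousLinearMap.adjoint X.range.subtypeL)
  have h3 := h2.clm_comp
    (ContinuousLinearMap.adjoint (X.codRestrict X.range fun y => ⟨y, rfl⟩))
  rw [h1, ContinuousLinearMap.adjoint_comp]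
  exact h3

theorem AbsNormAttaining.isCompactPerturbationAbove_blockOperator
    {A : H₂ →L[ℂ] H₂} {X : H₂ →L[ℂ] H₁}
    (hA : IsCompactPerturbationAbove A 1) [FiniteDimensional ℂ X.range] :
    IsCompactPerturbationAbove (blockOperator (ContinuousLinearMap.id ℂ H₁) X
      (ContinuousLinearMap.adjoint X) A) 1 := by
  obtain ⟨hC, V, hV, hpos⟩ := hA
  refine ⟨?_, X.range.map (WithLp.inlL₂ H₁ H₂).toLinearMap ⊔
    V.map (WithLp.inrL₂ H₁ H₂).toLinearMap, inferInstance, ?_⟩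
  · have h1 := ((IsCompactOperator.of_finiteDimensional_range X).comp_clm
      (WithLp.sndL 2 ℂ H₁ H₂)).clm_comp (WithLp.inlL₂ H₁ H₂)
    have h2 := ((IsCompactOperator.adjoint_of_finiteDimensional_range X).comp_clm
      (WithLp.fstL 2 ℂ H₁ H₂)).clm_comp (WithLp.inrL₂ H₁ H₂)
    have h3 := (hC.comp_clm (WithLp.sndL 2 ℂ H₁ H₂)).clm_comp (WithLp.inrL₂ H₁ H₂)
    refine (congrArg IsCompactOperator (funext fun z => ?_)).mpr ((h1.add h2).add h3)
    -- `T - 1` has the entries `X`, `X†` and `A - 1`, all of them compact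
    set D := blockOperator (ContinuousLinearMap.id ℂ H₁) X (ContinuousLinearMap.adjoint X) A -
      ((1 : ℝ) : ℂ) • ContinuousLinearMap.id ℂ (WithLp 2 (H₁ × H₂)) with hD
    change D z = WithLp.inlL₂ H₁ H₂ (X z.snd) +
      WithLp.inrL₂ H₁ H₂ (ContinuousLinearMap.adjoint X z.fst) +
      WithLp.inrL₂ H₁ H₂
        ((A - ((1 : ℝ) : ℂ) • ContinuousLinearMap.id ℂ H₂) z.snd)
    apply (WithLp.equiv 2 (H₁ × H₂)).injective
    refine Prod.ext ?_ ?_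
    · simp [hD, WithLp.inlL₂_apply, WithLp.inrL₂_apply, blockOperator_apply]
    · simp [hD, WithLp.inlL₂_apply, WithLp.inrL₂_apply, blockOperator_apply, add_sub_assoc]
  · intro z hz
    have hx : ⟪X z.snd, z.fst⟫_ℂ = 0 := by
      have := hz (WithLp.inlL₂ H₁ H₂ (X z.snd)) (Submodule.mem_sup_left ⟨_, ⟨_, rfl⟩, rfl⟩)
      rw [WithLp.prod_inner_apply] at this
      simpa [WithLp.inlL₂_apply] using this
    have hy : z.snd ∈ Vᗮ := fun u hu => by
      have := hz (WithLp.inrL₂ H₁ H₂ u) (Submodule.mem_sup_right ⟨_, hu, rfl⟩)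
      rw [WithLp.prod_inner_apply] at this
      simpa [WithLp.inrL₂_apply] using this
    have h1 : z = WithLp.toLp 2 (z.fst, z.snd) := rfl
    rw [h1, re_inner_blockOperator_id, WithLp.norm_sq_toLp_prod, hx, map_zero]
    have := hpos _ hy
    linarith

end BlockOperator

theorem mainTheorem2
    {H₁ : Type*} [NormedAddCommGroup H₁] [InnerProductSpace ℂ H₁] [CompleteSpace H₁]
    [TopologicalSpace.SeparableSpace H₁] (hH₁ : ¬ FiniteDimensional ℂ H₁)
    {H₂ : Type*} [NormedAddCommGroup H₂] [InnerProductSpace ℂ H₂] [CompleteSpace H₂]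
    [TopologicalSpace.SeparableSpace H₂] (hH₂ : ¬ FiniteDimensional ℂ H₂)
    (A : H₂ →L[ℂ] H₂) (hA : A.IsPositive) (X : H₂ →L[ℂ] H₁)
    (hT : (AbsNormAttaining.blockOperator (ContinuousLinearMap.id ℂ H₁) X
      (ContinuousLinearMap.adjoint X) A).IsPositive) :
    AbsNormAttaining.IsAN (AbsNormAttaining.blockOperator (ContinuousLinearMap.id ℂ H₁) X
        (ContinuousLinearMap.adjoint X) A) ↔
      (AbsNormAttaining.IsAN A ∧ AbsNormAttaining.essentialSpectrum A = {1}) ∧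
        FiniteDimensional ℂ X.range := by
  constructor
  · intro h
    have hinf : ¬ FiniteDimensional ℂ (WithLp 2 (H₁ × H₂)) := fun hfin =>
      hH₁ (FiniteDimensional.of_injective (WithLp.inlL₂ H₁ H₂).toLinearMap fun x y hxy =>
        congrArg WithLp.fst hxy)
    obtain ⟨α, -, hα⟩ := h.exists_isCompactPerturbationAbove hT hinf
    obtain ⟨h1, hX⟩ := of_isCompactPerturbationAbove_blockOperator hH₁ hα
    refine ⟨⟨h1.isAN hA.isSelfAdjoint zero_le_one, ?_⟩, hX⟩
    simpa using essentialSpectrum_eq_singleton hH₂ hA.isSelfAdjoint h1.1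
  · rintro ⟨⟨hAN, hess⟩, hX⟩
    obtain ⟨α, -, hα⟩ := hAN.exists_isCompactPerturbationAbove hA hH₂
    have h1 : α = 1 := by
      rw [essentialSpectrum_eq_singleton hH₂ hA.isSelfAdjoint hα.1,
        Set.singleton_eq_singleton_iff] at hess
      exact_mod_cast hess
    subst h1
    exact (isCompactPerturbationAbove_blockOperator hα).isAN hT.isSelfAdjoint zero_le_one
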